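/- Throughout, C*-algebras and *-homomorphisms are unital, Hilbert spaces are complex with inner products conjugate-linear in the first variable, $B(K)$ is the algebra of bounded operators on $K$, and $\mathcal{CAT}$ is the 2-category of (large) categories. For a C*-algebra $A$ consider the following categories. - $\mathbf{OCP}(A)$: objects are pairs $(K,\varphi)$ of a Hilbert space $K$ and a completely positive map $\varphi:A\to B(K)$; a morphism $(K,\varphi)\to(L,\psi)$ is a bounded operator $T:K\to L$ with $T\varphi(a)=\psi(a)T$ for all $a\in A$. $\mathbf{OpSt}(A)$ (operator states) is the subcategory of those $(K,\varphi)$ with $\varphi(1)=1$ and those $T$ that are isometries. - $\mathbf{AnRep}(A)$: objects (anchored representations) are quadruples $(K,H,\pi,V)$ of Hilbert spaces $K,H$, a unital *-homomorphism $\pi:A\to B(H)$ and a bounded operator $V:K\to H$; a morphism $(K,H,\pi,V)\to(L,I,\rho,W)$ is a pair of bounded operators $T:K\to L$, $S:H\to I$ with $S\pi(a)=\rho(a)S$ for all $a\in A$, $SV=WT$ and $TV^*=W^*S$. $\mathbf{PAnRep}(A)$ (preserving anchored representations) is the subcategory of those objects with $V$ an isometry and those morphisms with $T$ and $S$ isometries.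 A unital *-homomorphism $f:A'\to A$ acts by $\varphi\mapsto\varphi\circ f$, respectively $\pi\mapsto\pi\circ f$, and identically on morphisms. This defines functors $\mathbf{OCP},\mathbf{OpSt},\mathbf{AnRep},\mathbf{PAnRep}:\mathbf{C^*\text{-}Alg}^{\mathrm{op}}\to\mathcal{CAT}$. Let $\mathbf{Fun}(\mathbf{C^*\text{-}Alg}^{\mathrm{op}},\mathcal{CAT})$ be the 2-category of functors, oplax-natural transformations and modifications. Restriction $\mathbf{rest}:\mathbf{AnRep}\Rightarrow\mathbf{OCP}$ is given by $(K,H,\pi,V)\mapsto(K,\mathrm{Ad}_{V^*}\circ\pi)$, where $(\mathrm{Ad}_{V^*}\circ\pi)(a)=V^*\pi(a)V$, and $(T,S)\mapsto T$. Stinespring's construction $\mathbf{Stine}_A:\mathbf{OCP}(A)\to\mathbf{AnRep}(A)$ sends $(K,\varphi)$ to $(K,H_\varphi,\pi_\varphi,V_\varphi)$, where $H_\varphi$ is the completion of the quotient of the algebraic tensor product $A\otimes K$ by the null space of the positive semidefinite form $\langle\!\langle a\otimes v,b\otimes w\rangle\!\rangle=\langle v,\varphi(a^*b)w\rangle$,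 $\pi_\varphi(a)[b\otimes v]=[ab\otimes v]$ and $V_\varphi v=[1\otimes v]$; it sends a morphism $T$ to $(T,L_T)$ with $L_T[a\otimes v]=[a\otimes Tv]$. For $f:A'\to A$ the 2-cell $\mathbf{Stine}_f:\mathbf{Stine}_{A'}\circ\mathbf{OCP}_f\Rightarrow\mathbf{AnRep}_f\circ\mathbf{Stine}_A$ has component $(\mathrm{id}_K,L_f)$ at $(K,\varphi)$, where $L_f:H_{\varphi\circ f}\to H_\varphi$, $L_f[a'\otimes v]=[f(a')\otimes v]$. Let $m_A:\mathbf{Stine}_A\circ\mathbf{rest}_A\Rightarrow\mathrm{id}_{\mathbf{AnRep}(A)}$ have component $(\mathrm{id}_K,m_{\pi,V})$ at $(K,H,\pi,V)$, where $m_{\pi,V}:H_{\mathrm{Ad}_{V^*}\circ\pi}\to H$, $m_{\pi,V}[a\otimes v]=\pi(a)Vv$. **Theorem.** All of the above is well defined: $\mathbf{rest}:\mathbf{AnRep}\Rightarrow\mathbf{OCP}$ is a (strictly) natural transformation, $\mathbf{Stine}:\mathbf{OCP}\Rightarrow\mathbf{AnRep}$ is an oplax-natural transformation, and $m:\mathbf{Stine}\circ\mathbf{rest}\Rrightarrow\mathrm{id}_{\mathbf{AnRep}}$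 is a modification. Moreover $\mathbf{rest}\circ\mathbf{Stine}=\mathrm{id}_{\mathbf{OCP}}$, and $\mathbf{Stine}$ is left adjoint to $\mathbf{rest}$ in the 2-category $\mathbf{Fun}(\mathbf{C^*\text{-}Alg}^{\mathrm{op}},\mathcal{CAT})$, with unit the identity and counit $m$. Furthermore, $\mathbf{rest}$, $\mathbf{Stine}$ and $m$ restrict to $\mathbf{PAnRep}$ and $\mathbf{OpSt}$, and the restrictions $\mathbf{Stine}:\mathbf{OpSt}\Rightarrow\mathbf{PAnRep}$ and $\mathbf{rest}:\mathbf{PAnRep}\Rightarrow\mathbf{OpSt}$ again satisfy $\mathbf{rest}\circ\mathbf{Stine}=\mathrm{id}_{\mathbf{OpSt}}$ and form an adjunction $\mathbf{Stine}\dashv\mathbf{rest}$ in $\mathbf{Fun}(\mathbf{C^*\text{-}Alg}^{\mathrm{op}},\mathcal{CAT})$ with unit the identity and counit the restriction of $m$. -/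

import Mathlib

open CategoryTheory Bicategory
open scoped TensorProduct InnerProductSpace CStarAlgebra
open scoped Oplax.OplaxTrans Oplax.OplaxTrans.OplaxFunctor

universe u

namespace Stinespring

theorem exists_negPart {B : Type*} [CStarAlgebra B] [PartialOrder B] [StarOrderedRing B]
    {P : B} (hP : IsSelfAdjoint P) :
    ∃ N : B, 0 ≤ N ∧ star N = N ∧ P * N = -(N * N) ∧ (N = 0 → 0 ≤ P) := by
  refine ⟨P⁻, CFC.negPart_nonneg P, (IsSelfAdjoint.of_nonneg (CFC.negPart_nonneg P)).star_eq,
    ?_, (CFC.negPart_eq_zero_iff P hP).mp⟩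
  conv_lhs => enter [1]; rw [← CFC.posPart_sub_negPart P hP]
  rw [sub_mul, CFC.posPart_mul_negPart, zero_sub]

theorem exists_eq_star_mul_self {B : Type*} [CStarAlgebra B] [PartialOrder B] [StarOrderedRing B]
    {P : B} (hP : 0 ≤ P) : ∃ S : B, P = star S * S :=
  CStarAlgebra.nonneg_iff_eq_star_mul_self.mp hP

section Matrices

variable {n : Type*} [Fintype n] [DecidableEq n]
  {K : Type*} [NormedAddCommGroup K] [InnerProductSpace ℂ K] [CompleteSpace K]

/-- The action of a matrix of operators on a column of vectors. -/
noncomputable def matAct (M : CStarMatrix n n (K →L[ℂ] K)) (v : n → K) : n → K :=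
  fun i => ∑ j, M i j (v j)

theorem matAct_mul (M N : CStarMatrix n n (K →L[ℂ] K)) (v : n → K) :
    matAct (M * N) v = matAct M (matAct N v) := by
  funext i
  simp only [matAct, CStarMatrix.mul_apply, map_sum, sum_apply,
    mul_apply_eq_comp]
  exact Finset.sum_comm

theorem matAct_star (M : CStarMatrix n n (K →L[ℂ] K)) (v w : n → K) :
    ∑ i, ⟪v i, matAct (star M) w i⟫_ℂ = ∑ i, ⟪matAct M v i, w i⟫_ℂ := by
  simp only [matAct, CStarMatrix.star_apply, inner_sum, sum_inner,
    ContinuousLinearMap.star_eq_adjoint, ContinuousLinearMap.adjoint_inner_right]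
  exact Finset.sum_comm

theorem eq_zero_of_matAct {M : CStarMatrix n n (K →L[ℂ] K)} (h : ∀ v, matAct M v = 0) :
    M = 0 := by
  ext i j x
  have := congrFun (h (Pi.single j x)) i
  simpa [matAct, Pi.single_apply, apply_ite] using this

theorem column_sum (w : n → K) :
    ∑ i, ⟪w i, w i⟫_ℂ = ((∑ i, ‖w i‖ ^ 2 : ℝ) : ℂ) := by
  push_cast
  exact Finset.sum_congr rfl fun i _ => inner_self_eq_norm_sq_to_K _

theorem column_eq_zero {w : n → K} (h : ∑ i, ⟪w i, w i⟫_ℂ = 0) : w = 0 := by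
  rw [column_sum] at h
  have h6 := (Finset.sum_eq_zero_iff_of_nonneg
    (fun i _ => sq_nonneg ‖w i‖)).mp (Complex.ofReal_eq_zero.mp h)
  funext i
  simpa using h6 i (Finset.mem_univ i)

theorem matAct_nonneg {M : CStarMatrix n n (K →L[ℂ] K)} (hM : 0 ≤ M) (v : n → K) :
    0 ≤ (∑ i, ⟪v i, matAct M v i⟫_ℂ).re ∧
      ((∑ i, ⟪v i, matAct M v i⟫_ℂ).re = 0 → matAct M v = 0) := by
  obtain ⟨S, rfl⟩ := exists_eq_star_mul_self hM
  have h : ∑ i, ⟪v i, matAct (star S * S) v i⟫_ℂ = ((∑ i, ‖matAct S v i‖ ^ 2 : ℝ) : ℂ) := by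
    rw [matAct_mul, matAct_star, column_sum]
  rw [h, Complex.ofReal_re]
  refine ⟨by positivity, fun h0 => ?_⟩
  have h1 : matAct S v = 0 := column_eq_zero (by rw [column_sum, h0, Complex.ofReal_zero])
  rw [matAct_mul, h1]
  funext i
  simp [matAct]

/-- A self-adjoint matrix of operators with nonnegative quadratic form is positive. -/
theorem cstarMatrix_nonneg_of_form {P : CStarMatrix n n (K →L[ℂ] K)} (hP : IsSelfAdjoint P)
    (h : ∀ v : n → K, 0 ≤ (∑ i, ⟪v i, matAct P v i⟫_ℂ).re) : 0 ≤ P := by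
  obtain ⟨N, hN0, hNs, hPN, hN⟩ := exists_negPart hP
  refine hN ?_
  have key : ∀ v, matAct N v = 0 := by
    intro v
    have e1 : matAct P (matAct N v) = - matAct N (matAct N v) := by
      rw [← matAct_mul, ← matAct_mul, hPN]
      funext i
      simp [matAct]
    have h1 := h (matAct N v)
    have h2 := matAct_nonneg hN0 (matAct N v)
    rw [e1] at h1
    simp only [Pi.neg_apply, inner_neg_right, Finset.sum_neg_distrib, Complex.neg_re] at h1
    have h3 := h2.2 (by linarith [h2.1])
    have h4 := matAct_star N v (matAct N v)
    rw [hNs, h3] at h4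
    have h7 : ∑ i, ⟪matAct N v i, matAct N v i⟫_ℂ = 0 := by
      rw [← h4]
      exact Finset.sum_eq_zero fun i _ => inner_zero_right _
    exact column_eq_zero h7
  exact eq_zero_of_matAct key

end Matrices

section Space

variable {A : Type*} [CStarAlgebra A] [PartialOrder A] [StarOrderedRing A]
  {K : Type*} [NormedAddCommGroup K] [InnerProductSpace ℂ K] [CompleteSpace K]
  (φ : A →CP (K →L[ℂ] K))

/-- For `a : A` and `v : K`, the linear functional `b ⊗ w ↦ ⟪v, φ (a* b) w⟫` on `A ⊗ K`. -/
noncomputable def stineFunctional (a : A) (v : K) : A ⊗[ℂ] K →ₗ[ℂ] ℂ :=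
  TensorProduct.lift (LinearMap.mk₂ ℂ (fun (b : A) (w : K) => ⟪v, φ (star a * b) w⟫_ℂ)
    (fun b b' w => by simp [mul_add, inner_add_right])
    (fun c b w => by simp [inner_smul_right])
    (fun b w w' => by simp [inner_add_right])
    (fun c b w => by simp [inner_smul_right]))

theorem stineFunctional_tmul (a b : A) (v w : K) :
    stineFunctional φ a v (b ⊗ₜ w) = ⟪v, φ (star a * b) w⟫_ℂ := rfl

/-- The sesquilinear form on `A ⊗ K` with `⟪⟪a ⊗ v, b ⊗ w⟫⟫ = ⟪v, φ (a* b) w⟫`. -/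
noncomputable def stineForm : A ⊗[ℂ] K →ₛₗ[starRingEnd ℂ] A ⊗[ℂ] K →ₗ[ℂ] ℂ :=
  TensorProduct.lift (LinearMap.mk₂'ₛₗ (starRingEnd ℂ) (starRingEnd ℂ)
    (fun (a : A) (v : K) => stineFunctional φ a v)
    (fun a a' v => TensorProduct.ext' fun b w => by
      simp [stineFunctional_tmul, add_mul])
    (fun c a v => TensorProduct.ext' fun b w => by
      simp [stineFunctional_tmul])
    (fun a v v' => TensorProduct.ext' fun b w => by
      simp [stineFunctional_tmul, inner_add_left])
    (fun c a v => TensorProduct.ext' fun b w => by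
      simp [stineFunctional_tmul, inner_smul_left, mul_comm]))

@[simp]
theorem stineForm_tmul (a b : A) (v w : K) :
    stineForm φ (a ⊗ₜ v) (b ⊗ₜ w) = ⟪v, φ (star a * b) w⟫_ℂ := rfl

theorem stineForm_symm (ξ η : A ⊗[ℂ] K) :
    (starRingEnd ℂ) (stineForm φ η ξ) = stineForm φ ξ η := by
  induction ξ with
  | zero => simp
  | add x y hx hy => simp [hx, hy]
  | tmul a v =>
    induction η with
    | zero => simp
    | add x y hx hy => simp [hx, hy]
    | tmul b w =>
      rw [stineForm_tmul, stineForm_tmul, inner_conj_symm,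
        ← ContinuousLinearMap.adjoint_inner_right, ← ContinuousLinearMap.star_eq_adjoint,
        ← map_star φ, star_mul, star_star]

/-- The quadratic form of the matrix `(φ (aᵢ* aⱼ))` is nonnegative. -/
theorem form_sum_nonneg {n : Type*} [Fintype n] [DecidableEq n] (a : n → A) (v : n → K) :
    0 ≤ (∑ i, ∑ j, ⟪v i, φ (star (a i) * a j) (v j)⟫_ℂ).re := by
  rcases isEmpty_or_nonempty n with hn | ⟨⟨i₀⟩⟩
  · simp
  set N : CStarMatrix n n A := CStarMatrix.ofMatrix (Matrix.of fun i j => if i = i₀ then a j else 0)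
    with hN
  have h1 : 0 ≤ star N * N := star_mul_self_nonneg N
  have h2 := (matAct_nonneg (φ.map_cstarMatrix_nonneg _ h1) v).1
  convert h2 using 3 with i
  rw [matAct, inner_sum]
  refine Finset.sum_congr rfl fun j _ => ?_
  have : (star N * N) i j = star (a i) * a j := by
    simp [CStarMatrix.mul_apply, CStarMatrix.star_apply, hN, CStarMatrix.ofMatrix_apply]
  rw [CStarMatrix.map_apply, this]

theorem stineForm_sum {n : Type*} [Fintype n] (a : n → A) (v : n → K) :
    stineForm φ (∑ i, a i ⊗ₜ v i) (∑ i, a i ⊗ₜ v i) =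
      ∑ i, ∑ j, ⟪v i, φ (star (a i) * a j) (v j)⟫_ℂ := by
  simp only [map_sum, LinearMap.sum_apply, stineForm_tmul]
  exact Finset.sum_comm

theorem exists_fin_sum (ξ : A ⊗[ℂ] K) :
    ∃ (n : ℕ) (a : Fin n → A) (v : Fin n → K), ξ = ∑ i, a i ⊗ₜ[ℂ] v i := by
  obtain ⟨S, rfl⟩ := TensorProduct.exists_finset ξ
  refine ⟨S.card, fun i => (S.equivFin.symm i).1.1, fun i => (S.equivFin.symm i).1.2, ?_⟩
  rw [← Finset.sum_coe_sort]
  exact (Equiv.sum_comp S.equivFin.symm (fun p => p.1.1 ⊗ₜ[ℂ] p.1.2)).symm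

theorem stineForm_nonneg (ξ : A ⊗[ℂ] K) : 0 ≤ (stineForm φ ξ ξ).re := by
  obtain ⟨n, a, v, rfl⟩ := exists_fin_sum ξ
  rw [stineForm_sum]
  exact form_sum_nonneg φ a v

/-- The algebraic tensor product `A ⊗ K`, to be equipped with the semi-inner product
determined by `φ`. -/
def PreStine (φ : A →CP (K →L[ℂ] K)) := A ⊗[ℂ] K

noncomputable instance : AddCommGroup (PreStine φ) := inferInstanceAs (AddCommGroup (A ⊗[ℂ] K))
noncomputable instance : Module ℂ (PreStine φ) := inferInstanceAs (Module ℂ (A ⊗[ℂ] K))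

/-- The identity map `A ⊗ K → PreStine φ`. -/
noncomputable def toPre : A ⊗[ℂ] K ≃ₗ[ℂ] PreStine φ := LinearEquiv.refl ℂ _

noncomputable abbrev preStineCore : PreInnerProductSpace.Core ℂ (PreStine φ) where
  inner x y := stineForm φ ((toPre φ).symm x) ((toPre φ).symm y)
  conj_inner_symm x y := stineForm_symm φ _ _
  re_inner_nonneg x := stineForm_nonneg φ _
  add_left x y z := by simp
  smul_left x y r := by simp

noncomputable instance : SeminormedAddCommGroup (PreStine φ) :=
  InnerProductSpace.Core.toSeminormedAddCommGroup (c := preStineCore φ)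
noncomputable instance : InnerProductSpace ℂ (PreStine φ) :=
  InnerProductSpace.ofCore (preStineCore φ)

theorem pre_inner (ξ η : A ⊗[ℂ] K) : ⟪toPre φ ξ, toPre φ η⟫_ℂ = stineForm φ ξ η := rfl

/-- The Stinespring space `H_φ`: the completion of `(A ⊗ K) / N_φ`, where `N_φ` is the null space
of the semi-inner product. (The completion of a seminormed space is Hausdorff, and so
identifies vectors whose difference has norm zero.) -/
abbrev StineSpace := UniformSpace.Completion (PreStine φ)

/-- The class `[a ⊗ v]` in `H_φ` of an elementary tensor. -/
noncomputable def cls (a : A) (v : K) : StineSpace φ := (toPre φ (a ⊗ₜ v) : PreStine φ)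

theorem inner_cls (a b : A) (v w : K) :
    ⟪cls φ a v, cls φ b w⟫_ℂ = ⟪v, φ (star a * b) w⟫_ℂ := by
  rw [cls, cls, UniformSpace.Completion.inner_coe]
  rfl

variable {φ} in
/-- Two bounded operators on `H_φ` that agree on the classes of elementary tensors are equal. -/
theorem clm_ext {E : Type*} [NormedAddCommGroup E] [InnerProductSpace ℂ E]
    {S T : StineSpace φ →L[ℂ] E} (h : ∀ a v, S (cls φ a v) = T (cls φ a v)) : S = T := by
  ext x
  induction x using UniformSpace.Completion.induction_on with
  | hp => exact isClosed_eq S.continuous T.continuous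
  | ih x =>
    have : ∀ ξ : A ⊗[ℂ] K, S (toPre φ ξ : PreStine φ) = T (toPre φ ξ : PreStine φ) := by
      intro ξ
      induction ξ with
      | zero => rw [map_zero, UniformSpace.Completion.coe_zero, map_zero, map_zero]
      | add x y hx hy => simp [UniformSpace.Completion.coe_add, hx, hy]
      | tmul a v => exact h a v
    exact this x

theorem re_sum_sum_inner {E : Type*} [NormedAddCommGroup E] [InnerProductSpace ℂ E]
    {n : Type*} [Fintype n] (x : n → E) :
    ‖∑ i, x i‖ ^ 2 = (∑ i, ∑ j, ⟪x i, x j⟫_ℂ).re := by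
  rw [norm_sq_eq_re_inner (𝕜 := ℂ), sum_inner]
  simp_rw [inner_sum]
  rfl

variable {φ} in
/-- A bilinear map on `A × K` which is bounded for the semi-inner product determined by `φ`
induces a bounded operator on `H_φ`. -/
noncomputable def extend {E : Type*} [NormedAddCommGroup E] [InnerProductSpace ℂ E]
    [CompleteSpace E] (g : A →ₗ[ℂ] K →ₗ[ℂ] E) (C : ℝ) (hC : 0 ≤ C)
    (h : ∀ (n : ℕ) (a : Fin n → A) (v : Fin n → K),
      (∑ i, ∑ j, ⟪g (a i) (v i), g (a j) (v j)⟫_ℂ).re ≤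
        C ^ 2 * (∑ i, ∑ j, ⟪v i, φ (star (a i) * a j) (v j)⟫_ℂ).re) : StineSpace φ →L[ℂ] E :=
  (LinearMap.mkContinuous (TensorProduct.lift g ∘ₗ (toPre φ).symm.toLinearMap) C (fun x => by
    have h1 : ‖x‖ ^ 2 = (stineForm φ ((toPre φ).symm x) ((toPre φ).symm x)).re :=
      norm_sq_eq_re_inner (𝕜 := ℂ) x
    rw [← sq_le_sq₀ (by positivity) (by positivity), mul_pow, h1]
    obtain ⟨n, a, v, hx⟩ := exists_fin_sum ((toPre φ).symm x)
    rw [LinearMap.comp_apply, LinearEquiv.coe_coe, hx, stineForm_sum, map_sum, re_sum_sum_inner]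
    exact h n a v)).extend (UniformSpace.Completion.toComplL (𝕜 := ℂ) (E := PreStine φ))

variable {φ} in
@[simp]
theorem extend_cls {E : Type*} [NormedAddCommGroup E] [InnerProductSpace ℂ E]
    [CompleteSpace E] (g : A →ₗ[ℂ] K →ₗ[ℂ] E) (C : ℝ) (hC : 0 ≤ C) (h) (a : A) (v : K) :
    extend (φ := φ) g C hC h (cls φ a v) = g a v :=
  ContinuousLinearMap.extend_eq _ UniformSpace.Completion.denseRange_coe
    (UniformSpace.Completion.isUniformInducing_coe _) _

/-- The bilinear map `(a, v) ↦ [a ⊗ v]`. -/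
noncomputable def clsₗ : A →ₗ[ℂ] K →ₗ[ℂ] StineSpace φ :=
  (TensorProduct.mk ℂ A K).compr₂
    ((UniformSpace.Completion.toComplL (𝕜 := ℂ) (E := PreStine φ)).toLinearMap ∘ₗ
      (toPre φ).toLinearMap)

@[simp]
theorem clsₗ_apply (a : A) (v : K) : clsₗ φ a v = cls φ a v := rfl

/-- The Stinespring representation on operators: `π_φ(a) [b ⊗ v] = [a b ⊗ v]`. -/
noncomputable def stineMul (a : A) : StineSpace φ →L[ℂ] StineSpace φ :=
  extend (clsₗ φ ∘ₗ LinearMap.mulLeft ℂ a) ‖a‖ (norm_nonneg a) (fun n b v => by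
    have h0 : 0 ≤ algebraMap ℝ A (‖a‖ ^ 2) - star a * a := by
      rw [sub_nonneg, ← sq_abs, abs_norm]
      simpa [Algebra.algebraMap_eq_smul_one, sq, CStarRing.norm_star_mul_self] using
        (IsSelfAdjoint.star_mul_self a).le_algebraMap_norm_self
    obtain ⟨c, hc⟩ := exists_eq_star_mul_self h0
    have h1 := form_sum_nonneg φ (fun i => c * b i) v
    have h2 : ∀ i j, ⟪v i, φ (star (c * b i) * (c * b j)) (v j)⟫_ℂ =
        ((‖a‖ ^ 2 : ℝ) : ℂ) * ⟪v i, φ (star (b i) * b j) (v j)⟫_ℂ -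
          ⟪v i, φ (star (a * b i) * (a * b j)) (v j)⟫_ℂ := by
      intro i j
      have : star (c * b i) * (c * b j) =
          ((‖a‖ ^ 2 : ℝ) : ℂ) • (star (b i) * b j) - star (a * b i) * (a * b j) := by
        calc star (c * b i) * (c * b j) = star (b i) * (star c * c) * b j := by
              simp [mul_assoc]
          _ = _ := by
              rw [← hc, mul_sub, sub_mul, Algebra.algebraMap_eq_smul_one, Complex.coe_smul]
              simp [mul_assoc]
      rw [this, map_sub, map_smul]
      simp only [ContinuousLinearMap.sub_apply, ContinuousLinearMap.smul_apply, inner_sub_right,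
        inner_smul_right]
    simp only [h2, Finset.sum_sub_distrib, ← Finset.mul_sum, Complex.sub_re,
      Complex.re_ofReal_mul] at h1
    simp only [LinearMap.comp_apply, LinearMap.mulLeft_apply, clsₗ_apply, inner_cls]
    linarith)

@[simp]
theorem stineMul_cls (a b : A) (v : K) : stineMul φ a (cls φ b v) = cls φ (a * b) v := by
  simp [stineMul]

theorem cls_add (a b : A) (v : K) : cls φ (a + b) v = cls φ a v + cls φ b v := by
  rw [← clsₗ_apply, map_add, LinearMap.add_apply]; rfl

theorem cls_smul (c : ℂ) (a : A) (v : K) : cls φ (c • a) v = c • cls φ a v := by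
  rw [← clsₗ_apply, map_smul, LinearMap.smul_apply]; rfl

/-- The Stinespring representation `π_φ : A → B(H_φ)`, a unital *-homomorphism. -/
noncomputable def stineRep : A →⋆ₐ[ℂ] (StineSpace φ →L[ℂ] StineSpace φ) where
  toFun a := stineMul φ a
  map_one' := clm_ext fun b v => by simp
  map_mul' a a' := clm_ext fun b v => by simp [mul_assoc]
  map_zero' := clm_ext fun b v => by
    rw [stineMul_cls, zero_mul, ← clsₗ_apply, map_zero]; simp
  map_add' a a' := clm_ext fun b v => by simp [add_mul, cls_add]
  commutes' r := clm_ext fun b v => by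
    simp [Algebra.algebraMap_eq_smul_one, cls_smul]
  map_star' a := by
    rw [ContinuousLinearMap.star_eq_adjoint]
    refine clm_ext fun b v => ?_
    refine ext_inner_left ℂ fun y => ?_
    rw [ContinuousLinearMap.adjoint_inner_right]
    have : (innerSL ℂ (stineMul φ (star a) (cls φ b v)) : StineSpace φ →L[ℂ] ℂ) =
        (innerSL ℂ (cls φ b v)) ∘L stineMul φ a := clm_ext fun c w => by
      simp [inner_cls, mul_assoc]
    have h := congrArg (starRingEnd ℂ) (DFunLike.congr_fun this y)
    simpa [inner_conj_symm] using h

@[simp]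
theorem stineRep_cls (a b : A) (v : K) : stineRep φ a (cls φ b v) = cls φ (a * b) v :=
  stineMul_cls φ a b v

/-- The operator `V_φ : K → H_φ`, `V_φ v = [1 ⊗ v]`. -/
noncomputable def stineV : K →L[ℂ] StineSpace φ :=
  (clsₗ φ 1).mkContinuous (Real.sqrt ‖φ 1‖) fun v => by
    rw [← sq_le_sq₀ (by positivity) (by positivity), mul_pow, Real.sq_sqrt (norm_nonneg _),
      norm_sq_eq_re_inner (𝕜 := ℂ), clsₗ_apply, inner_cls, star_one, one_mul, sq, ← mul_assoc]
    calc RCLike.re ⟪v, φ 1 v⟫_ℂ ≤ ‖⟪v, φ 1 v⟫_ℂ‖ := RCLike.re_le_norm _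
      _ ≤ ‖v‖ * ‖φ 1 v‖ := norm_inner_le_norm _ _
      _ ≤ ‖v‖ * (‖φ 1‖ * ‖v‖) := by gcongr; exact (φ 1).le_opNorm v
      _ = ‖φ 1‖ * ‖v‖ * ‖v‖ := by ring

@[simp]
theorem stineV_apply (v : K) : stineV φ v = cls φ 1 v := rfl

/-- `V_φ* [a ⊗ v] = φ(a) v`. -/
@[simp]
theorem stineV_adjoint_cls (a : A) (v : K) : (stineV φ).adjoint (cls φ a v) = φ a v := by
  refine ext_inner_left ℂ fun w => ?_
  rw [ContinuousLinearMap.adjoint_inner_right, stineV_apply, inner_cls, star_one, one_mul]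

end Space

section Maps

variable {A : Type*} [CStarAlgebra A] [PartialOrder A] [StarOrderedRing A]
  {K : Type*} [NormedAddCommGroup K] [InnerProductSpace ℂ K] [CompleteSpace K]
  {L : Type*} [NormedAddCommGroup L] [InnerProductSpace ℂ L] [CompleteSpace L]
  {H : Type*} [NormedAddCommGroup H] [InnerProductSpace ℂ H] [CompleteSpace H]
  (φ : A →CP (K →L[ℂ] K)) (ψ : A →CP (L →L[ℂ] L))

variable {φ} in
theorem vec_ext {x y : StineSpace φ} (h : ∀ a v, ⟪cls φ a v, x⟫_ℂ = ⟪cls φ a v, y⟫_ℂ) : x = y := by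
  have : (innerSL ℂ x : StineSpace φ →L[ℂ] ℂ) = innerSL ℂ y := clm_ext fun a v => by
    have := congrArg (starRingEnd ℂ) (h a v)
    simpa [inner_conj_symm] using this
  exact (innerSL_inj).mp this

variable {φ} in
theorem isometry_of_inner {S : StineSpace φ →L[ℂ] H}
    (h : ∀ a v b w, ⟪S (cls φ a v), S (cls φ b w)⟫_ℂ = ⟪cls φ a v, cls φ b w⟫_ℂ) :
    Isometry S := by
  have : S.adjoint ∘L S = 1 := clm_ext fun b w => vec_ext fun a v => by
    simp [ContinuousLinearMap.adjoint_inner_right, h]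
  exact AddMonoidHomClass.isometry_of_norm S (S.norm_map_iff_adjoint_comp_self.mpr this)

theorem intertwine_adjoint {T : K →L[ℂ] L} (hT : ∀ a, T ∘L φ a = ψ a ∘L T) (a : A) :
    T.adjoint ∘L ψ a = φ a ∘L T.adjoint := by
  have h1 : ∀ a, (φ a).adjoint = φ (star a) := fun a => (map_star φ a).symm
  have h2 : ∀ a, (ψ a).adjoint = ψ (star a) := fun a => (map_star ψ a).symm
  have := congrArg ContinuousLinearMap.adjoint (hT (star a))
  rw [ContinuousLinearMap.adjoint_comp, ContinuousLinearMap.adjoint_comp, h1, h2, star_star] at this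
  exact this.symm

/-- If `S ≥ 0` commutes with the values of `φ`, then `S φ` has nonnegative quadratic forms. -/
theorem form_sum_nonneg_of_commute {S : K →L[ℂ] K} (hS : 0 ≤ S) (hc : ∀ a, Commute S (φ a))
    {n : Type*} [Fintype n] [DecidableEq n] (a : n → A) (v : n → K) :
    0 ≤ (∑ i, ∑ j, ⟪v i, S (φ (star (a i) * a j) (v j))⟫_ℂ).re := by
  set R := CFC.sqrt S with hR
  have hRR : R * R = S := CFC.sqrt_mul_sqrt_self S hS
  have hRs : IsSelfAdjoint R := IsSelfAdjoint.of_nonneg (CFC.sqrt_nonneg S)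
  have hRc : ∀ a, Commute R (φ a) := fun a => by
    rw [hR, CFC.sqrt]
    exact (hc a).cfcₙ_nnreal _
  have e : ∀ i j, ⟪v i, S (φ (star (a i) * a j) (v j))⟫_ℂ =
      ⟪R (v i), φ (star (a i) * a j) (R (v j))⟫_ℂ := fun i j => by
    rw [← mul_apply_eq_comp (φ _) R, ← (hRc _).eq, ← hRR, mul_apply_eq_comp, mul_apply_eq_comp,
      ← ContinuousLinearMap.adjoint_inner_left, ← ContinuousLinearMap.star_eq_adjoint, hRs.star_eq]
  simp only [e]
  exact form_sum_nonneg φ a (fun i => R (v i))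

variable {φ ψ} in
theorem inner_intertwine {T : K →L[ℂ] L} (hT : ∀ a, T ∘L φ a = ψ a ∘L T) (a : A) (v w : K) :
    ⟪T v, ψ a (T w)⟫_ℂ = ⟪v, (T.adjoint ∘L T) (φ a w)⟫_ℂ := by
  rw [← ContinuousLinearMap.comp_apply, ← hT, ContinuousLinearMap.comp_apply,
    ContinuousLinearMap.comp_apply, ContinuousLinearMap.adjoint_inner_right]

theorem normSq_sub_nonneg (T : K →L[ℂ] L) :
    0 ≤ ((‖T‖ ^ 2 : ℝ) : ℂ) • (1 : K →L[ℂ] K) - T.adjoint ∘L T := by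
  rw [ContinuousLinearMap.nonneg_iff_isPositive, ContinuousLinearMap.isPositive_def']
  refine ⟨IsSelfAdjoint.sub ?_ ?_, fun v => ?_⟩
  · rw [IsSelfAdjoint, star_smul, star_one, Complex.star_def, Complex.conj_ofReal]
  · rw [ContinuousLinearMap.isSelfAdjoint_iff', ContinuousLinearMap.adjoint_comp,
      ContinuousLinearMap.adjoint_adjoint]
  · rw [ContinuousLinearMap.reApplyInnerSelf_apply]
    simp only [ContinuousLinearMap.sub_apply, ContinuousLinearMap.smul_apply, inner_sub_left,
      inner_smul_left, one_apply_eq_self, ContinuousLinearMap.comp_apply,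
      ContinuousLinearMap.adjoint_inner_left, Complex.conj_ofReal, map_sub]
    have h2 : ‖T v‖ ^ 2 ≤ (‖T‖ * ‖v‖) ^ 2 := by gcongr; exact T.le_opNorm v
    have h3 := norm_sq_eq_re_inner (𝕜 := ℂ) (T v)
    have h4 := norm_sq_eq_re_inner (𝕜 := ℂ) v
    rw [← h3, ← RCLike.ofReal_eq_complex_ofReal, RCLike.re_ofReal_mul, ← h4]
    linarith [mul_pow ‖T‖ ‖v‖ 2]

/-- For `T` intertwining `φ` and `ψ`, the operator `L_T : H_φ → H_ψ`, `L_T [a ⊗ v] = [a ⊗ T v]`. -/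
noncomputable def stineMap (T : K →L[ℂ] L) (hT : ∀ a, T ∘L φ a = ψ a ∘L T) :
    StineSpace φ →L[ℂ] StineSpace ψ :=
  extend ((clsₗ ψ).compl₂ T.toLinearMap) ‖T‖ (norm_nonneg T) (fun n a v => by
    have hc : ∀ a, Commute (T.adjoint ∘L T) (φ a) := fun a => by
      change (T.adjoint ∘L T) ∘L φ a = φ a ∘L (T.adjoint ∘L T)
      rw [ContinuousLinearMap.comp_assoc, hT, ← ContinuousLinearMap.comp_assoc,
        intertwine_adjoint φ ψ hT, ContinuousLinearMap.comp_assoc]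
    have h0 : 0 ≤ ((‖T‖ ^ 2 : ℝ) : ℂ) • (1 : K →L[ℂ] K) - T.adjoint ∘L T := normSq_sub_nonneg T
    have h1 := form_sum_nonneg_of_commute φ h0
      (fun a => ((Commute.one_left (φ a)).smul_left _).sub_left (hc a)) a v
    simp only [ContinuousLinearMap.sub_apply, ContinuousLinearMap.smul_apply, inner_sub_right,
      inner_smul_right, one_apply_eq_self, Finset.sum_sub_distrib, ← Finset.mul_sum, Complex.sub_re,
      Complex.re_ofReal_mul, ← inner_intertwine hT] at h1
    simp only [LinearMap.compl₂_apply, clsₗ_apply, inner_cls]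
    change (∑ i, ∑ j, ⟪T (v i), ψ (star (a i) * a j) (T (v j))⟫_ℂ).re ≤ _
    linarith)

@[simp]
theorem stineMap_cls (T : K →L[ℂ] L) (hT : ∀ a, T ∘L φ a = ψ a ∘L T) (a : A) (v : K) :
    stineMap φ ψ T hT (cls φ a v) = cls ψ a (T v) := by
  simp [stineMap]

theorem stineMap_isometry (T : K →L[ℂ] L) (hT : ∀ a, T ∘L φ a = ψ a ∘L T) (hi : Isometry T) :
    Isometry (stineMap φ ψ T hT) := by
  have h1 : T.adjoint ∘L T = 1 :=
    T.norm_map_iff_adjoint_comp_self.mp ((AddMonoidHomClass.isometry_iff_norm T).mp hi)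
  refine isometry_of_inner fun a v b w => ?_
  rw [stineMap_cls, stineMap_cls, inner_cls, inner_cls, inner_intertwine hT, h1,
    one_apply_eq_self]

/-- The composite of a unital *-homomorphism with a completely positive map. -/
noncomputable def compCP {A' : Type*} [CStarAlgebra A'] [PartialOrder A'] [StarOrderedRing A']
    (f : A' →⋆ₐ[ℂ] A) : A' →CP (K →L[ℂ] K) where
  toFun a := φ (f a)
  map_add' a b := by simp
  map_smul' c a := by simp
  map_cstarMatrix_nonneg' k M hM :=
    φ.map_cstarMatrix_nonneg (M.map f) (CompletelyPositiveMapClass.map_cstarMatrix_nonneg' f k M hM)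

@[simp]
theorem compCP_apply {A' : Type*} [CStarAlgebra A'] [PartialOrder A'] [StarOrderedRing A']
    (f : A' →⋆ₐ[ℂ] A) (a : A') : compCP φ f a = φ (f a) := rfl

/-- The operator `L_f : H_{φ ∘ f} → H_φ`, `L_f [a ⊗ v] = [f a ⊗ v]`. -/
noncomputable def stineComp {A' : Type*} [CStarAlgebra A'] [PartialOrder A'] [StarOrderedRing A']
    (f : A' →⋆ₐ[ℂ] A) : StineSpace (compCP φ f) →L[ℂ] StineSpace φ :=
  extend (clsₗ φ ∘ₗ f.toAlgHom.toLinearMap) 1 zero_le_one (fun n a v => by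
    simp only [LinearMap.comp_apply, clsₗ_apply, inner_cls, compCP_apply, map_mul f, map_star f,
      one_pow, one_mul]
    exact le_refl _)

@[simp]
theorem stineComp_cls {A' : Type*} [CStarAlgebra A'] [PartialOrder A'] [StarOrderedRing A']
    (f : A' →⋆ₐ[ℂ] A) (a : A') (v : K) :
    stineComp φ f (cls (compCP φ f) a v) = cls φ (f a) v := by
  simp [stineComp]

theorem stineComp_isometry {A' : Type*} [CStarAlgebra A'] [PartialOrder A'] [StarOrderedRing A']
    (f : A' →⋆ₐ[ℂ] A) : Isometry (stineComp φ f) :=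
  isometry_of_inner fun a v b w => by
    rw [stineComp_cls, stineComp_cls, inner_cls, inner_cls, compCP_apply, map_mul f, map_star f]

/-- The completely positive map `a ↦ V* π(a) V`. -/
noncomputable def compress (π : A →⋆ₐ[ℂ] (H →L[ℂ] H)) (V : K →L[ℂ] H) : A →CP (K →L[ℂ] K) where
  toFun a := V.adjoint ∘L π a ∘L V
  map_add' a b := by ext; simp
  map_smul' c a := by ext; simp
  map_cstarMatrix_nonneg' k M hM := by
    have hs : ∀ a, star (V.adjoint ∘L π a ∘L V) = V.adjoint ∘L π (star a) ∘L V := fun a => by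
      rw [ContinuousLinearMap.star_eq_adjoint, ContinuousLinearMap.adjoint_comp,
        ContinuousLinearMap.adjoint_comp, ContinuousLinearMap.adjoint_adjoint, map_star,
        ContinuousLinearMap.star_eq_adjoint, ContinuousLinearMap.comp_assoc]
    refine cstarMatrix_nonneg_of_form ?_ fun v => ?_
    · have hM' := (IsSelfAdjoint.of_nonneg hM).star_eq
      ext1 i j
      have := congrArg (fun N => N i j) hM'
      simp only [CStarMatrix.star_apply] at this ⊢
      simp only [CStarMatrix.map_apply]
      change star (V.adjoint ∘L π (M j i) ∘L V) = V.adjoint ∘L π (M i j) ∘L V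
      rw [hs, this]
    · obtain ⟨S, rfl⟩ := exists_eq_star_mul_self hM
      have h : ∑ i, ⟪v i, matAct ((star S * S).map
          (fun a => V.adjoint ∘L π a ∘L V)) v i⟫_ℂ =
          ((∑ l, ‖∑ j, π (S l j) (V (v j))‖ ^ 2 : ℝ) : ℂ) := by
        have e : ∀ i j, ⟪v i, V.adjoint (π ((star S * S) i j) (V (v j)))⟫_ℂ =
            ∑ l, ⟪π (S l i) (V (v i)), π (S l j) (V (v j))⟫_ℂ := fun i j => by
          rw [ContinuousLinearMap.adjoint_inner_right, CStarMatrix.mul_apply, map_sum, sum_apply,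
            inner_sum]
          refine Finset.sum_congr rfl fun l _ => ?_
          rw [CStarMatrix.star_apply, map_mul, map_star, mul_apply_eq_comp,
            ContinuousLinearMap.star_eq_adjoint, ContinuousLinearMap.adjoint_inner_right]
        rw [← column_sum]
        simp only [matAct, inner_sum, sum_inner, CStarMatrix.map_apply,
          ContinuousLinearMap.comp_apply, e]
        rw [Finset.sum_comm]
        exact (Finset.sum_congr rfl fun _ _ => Finset.sum_comm).trans Finset.sum_comm
      change 0 ≤ (∑ i, ⟪v i, matAct ((star S * S).map
          (fun a => V.adjoint ∘L π a ∘L V)) v i⟫_ℂ).re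
      rw [h, Complex.ofReal_re]
      positivity

@[simp]
theorem compress_apply (π : A →⋆ₐ[ℂ] (H →L[ℂ] H)) (V : K →L[ℂ] H) (a : A) :
    compress π V a = V.adjoint ∘L π a ∘L V := rfl

theorem inner_compress (π : A →⋆ₐ[ℂ] (H →L[ℂ] H)) (V : K →L[ℂ] H) (a b : A) (v w : K) :
    ⟪v, compress π V (star a * b) w⟫_ℂ = ⟪π a (V v), π b (V w)⟫_ℂ := by
  rw [compress_apply, ContinuousLinearMap.comp_apply, ContinuousLinearMap.comp_apply,
    ContinuousLinearMap.adjoint_inner_right, map_mul, map_star, mul_apply_eq_comp,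
    ContinuousLinearMap.star_eq_adjoint, ContinuousLinearMap.adjoint_inner_right]

/-- The bilinear map `(a, v) ↦ π(a) V v`. -/
noncomputable def counitBilin (π : A →⋆ₐ[ℂ] (H →L[ℂ] H)) (V : K →L[ℂ] H) : A →ₗ[ℂ] K →ₗ[ℂ] H :=
  LinearMap.mk₂ ℂ (fun (a : A) (v : K) => π a (V v)) (by simp) (by simp) (by simp) (by simp)

@[simp]
theorem counitBilin_apply (π : A →⋆ₐ[ℂ] (H →L[ℂ] H)) (V : K →L[ℂ] H) (a : A) (v : K) :
    counitBilin π V a v = π a (V v) := rfl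

/-- The operator `m_{π,V} : H_{V*π(·)V} → H`, `m_{π,V} [a ⊗ v] = π(a) V v`. -/
noncomputable def counitMap (π : A →⋆ₐ[ℂ] (H →L[ℂ] H)) (V : K →L[ℂ] H) :
    StineSpace (compress π V) →L[ℂ] H :=
  extend (counitBilin π V) 1 zero_le_one (fun n a v => by
    simp only [counitBilin_apply, inner_compress, one_pow, one_mul, le_refl])

@[simp]
theorem counitMap_cls (π : A →⋆ₐ[ℂ] (H →L[ℂ] H)) (V : K →L[ℂ] H) (a : A) (v : K) :
    counitMap π V (cls _ a v) = π a (V v) := by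
  exact extend_cls (φ := compress π V) (counitBilin π V) 1 zero_le_one _ a v

theorem counitMap_isometry (π : A →⋆ₐ[ℂ] (H →L[ℂ] H)) (V : K →L[ℂ] H) :
    Isometry (counitMap π V) :=
  isometry_of_inner fun a v b w => by
    rw [counitMap_cls, counitMap_cls, inner_cls, inner_compress]

end Maps

section Relations

variable {A : Type*} [CStarAlgebra A] [PartialOrder A] [StarOrderedRing A]
  {A' : Type*} [CStarAlgebra A'] [PartialOrder A'] [StarOrderedRing A']
  {K : Type*} [NormedAddCommGroup K] [InnerProductSpace ℂ K] [CompleteSpace K]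
  {L : Type*} [NormedAddCommGroup L] [InnerProductSpace ℂ L] [CompleteSpace L]
  {H : Type*} [NormedAddCommGroup H] [InnerProductSpace ℂ H] [CompleteSpace H]
  {I : Type*} [NormedAddCommGroup I] [InnerProductSpace ℂ I] [CompleteSpace I]
  (φ : A →CP (K →L[ℂ] K)) (ψ : A →CP (L →L[ℂ] L)) (f : A' →⋆ₐ[ℂ] A)
  (π : A →⋆ₐ[ℂ] (H →L[ℂ] H)) (V : K →L[ℂ] H) (ρ : A →⋆ₐ[ℂ] (I →L[ℂ] I)) (W : L →L[ℂ] I)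

theorem stineComp_comm (a : A') :
    stineComp φ f ∘L stineRep (compCP φ f) a = stineRep φ (f a) ∘L stineComp φ f :=
  clm_ext fun b v => by simp

theorem stineComp_anchor :
    stineComp φ f ∘L stineV (compCP φ f) = stineV φ ∘L ContinuousLinearMap.id ℂ K := by
  ext v
  simp

theorem stineComp_anchor_adjoint :
    ContinuousLinearMap.id ℂ K ∘L (stineV (compCP φ f)).adjoint =
      (stineV φ).adjoint ∘L stineComp φ f :=
  clm_ext fun b v => by simp

theorem stineComp_natural (T : K →L[ℂ] L) (hT : ∀ a, T ∘L φ a = ψ a ∘L T)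
    (hT' : ∀ a, T ∘L compCP φ f a = compCP ψ f a ∘L T) :
    stineComp ψ f ∘L stineMap (compCP φ f) (compCP ψ f) T hT' =
      stineMap φ ψ T hT ∘L stineComp φ f :=
  clm_ext fun b v => by simp

theorem stineMap_comm (T : K →L[ℂ] L) (hT : ∀ a, T ∘L φ a = ψ a ∘L T) (a : A) :
    stineMap φ ψ T hT ∘L stineRep φ a = stineRep ψ a ∘L stineMap φ ψ T hT :=
  clm_ext fun b v => by simp

theorem stineMap_anchor (T : K →L[ℂ] L) (hT : ∀ a, T ∘L φ a = ψ a ∘L T) :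
    stineMap φ ψ T hT ∘L stineV φ = stineV ψ ∘L T := by
  ext v
  simp

theorem stineMap_anchor_adjoint (T : K →L[ℂ] L) (hT : ∀ a, T ∘L φ a = ψ a ∘L T) :
    T ∘L (stineV φ).adjoint = (stineV ψ).adjoint ∘L stineMap φ ψ T hT :=
  clm_ext fun b v => by simpa using DFunLike.congr_fun (hT b) v

theorem stineV_isometry (h : φ 1 = 1) : Isometry (stineV φ) := by
  refine (AddMonoidHomClass.isometry_iff_norm _).mpr fun v => ?_
  rw [← sq_eq_sq₀ (norm_nonneg _) (norm_nonneg _), norm_sq_eq_re_inner (𝕜 := ℂ),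
    norm_sq_eq_re_inner (𝕜 := ℂ), stineV_apply, inner_cls, star_one, one_mul, h, one_apply_eq_self]

theorem compress_one (h : Isometry V) : compress π V 1 = 1 := by
  rw [compress_apply, map_one]
  exact V.isometry_iff_adjoint_comp_self.mp h

theorem counitMap_comm (a : A) :
    counitMap π V ∘L stineRep (compress π V) a = π a ∘L counitMap π V :=
  clm_ext fun b v => by simp

theorem counitMap_anchor :
    counitMap π V ∘L stineV (compress π V) = V ∘L ContinuousLinearMap.id ℂ K := by
  ext v
  simp

theorem counitMap_anchor_adjoint :
    ContinuousLinearMap.id ℂ K ∘L (stineV (compress π V)).adjoint =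
      V.adjoint ∘L counitMap π V :=
  clm_ext fun b v => by simp

theorem counitMap_natural {T : K →L[ℂ] L} {S : H →L[ℂ] I} (hS : ∀ a, S ∘L π a = ρ a ∘L S)
    (hV : S ∘L V = W ∘L T) (hT : ∀ a, T ∘L compress π V a = compress ρ W a ∘L T) :
    counitMap ρ W ∘L stineMap (compress π V) (compress ρ W) T hT = S ∘L counitMap π V :=
  clm_ext fun b v => by
    have h1 := DFunLike.congr_fun (hS b) (V v)
    have h2 := DFunLike.congr_fun hV v
    simp only [ContinuousLinearMap.comp_apply] at h1 h2 ⊢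
    rw [stineMap_cls, counitMap_cls, counitMap_cls, h1, h2]

theorem counitMap_comp (hT : ∀ a, ContinuousLinearMap.id ℂ K ∘L compress (π.comp f) V a =
      compCP (compress π V) f a ∘L ContinuousLinearMap.id ℂ K) :
    counitMap π V ∘L stineComp (compress π V) f ∘L
      stineMap (compress (π.comp f) V) (compCP (compress π V) f) (ContinuousLinearMap.id ℂ K) hT =
      counitMap (π.comp f) V :=
  clm_ext fun b v => by simp

end Relations

end Stinespring

/-- The category of unital C*-algebras and unital *-homomorphisms. -/
structure CStarAlgCat : Type (u + 1) where
  /-- The underlying type. -/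
  carrier : Type u
  [str : CStarAlgebra carrier]

namespace CStarAlgCat

instance : CoeSort CStarAlgCat.{u} (Type u) := ⟨carrier⟩

instance (A : CStarAlgCat.{u}) : CStarAlgebra A := A.str

/-- The usual order of a C*-algebra: `0 ≤ a` if and only if `a = b* b` for some `b`. -/
noncomputable instance (A : CStarAlgCat.{u}) : PartialOrder A := CStarAlgebra.spectralOrder A

instance (A : CStarAlgCat.{u}) : StarOrderedRing A := CStarAlgebra.spectralOrderedRing A

instance : Category CStarAlgCat.{u} where
  Hom A B := A →⋆ₐ[ℂ] B
  id A := StarAlgHom.id ℂ A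
  comp f g := StarAlgHom.comp g f

end CStarAlgCat

namespace Stinespring

/-- An operator-valued completely positive map `(K, φ)` on `A`: a Hilbert space `K` and a
completely positive map `φ : A → B(K)`. -/
structure OCP (A : CStarAlgCat.{u}) : Type (u + 1) where
  K : Type u
  [group : NormedAddCommGroup K]
  [inner : InnerProductSpace ℂ K]
  [complete : CompleteSpace K]
  φ : A →CP (K →L[ℂ] K)

attribute [instance] OCP.group OCP.inner OCP.complete

namespace OCP

variable {A A' : CStarAlgCat.{u}}

/-- A morphism `(K, φ) → (L, ψ)`: a bounded operator `T : K → L` with `T φ(a) = ψ(a) T`. -/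
@[ext]
structure Hom (X Y : OCP A) : Type u where
  T : X.K →L[ℂ] Y.K
  comm : ∀ a, T ∘L X.φ a = Y.φ a ∘L T

instance : Category (OCP A) where
  Hom := Hom
  id X := ⟨ContinuousLinearMap.id ℂ X.K, fun _ => rfl⟩
  comp f g := ⟨g.T ∘L f.T, fun a => by
    rw [ContinuousLinearMap.comp_assoc, f.comm, ← ContinuousLinearMap.comp_assoc, g.comm,
      ContinuousLinearMap.comp_assoc]⟩

@[ext]
theorem hom_ext {X Y : OCP A} {f g : X ⟶ Y} (h : f.T = g.T) : f = g := Hom.ext h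

@[simp] theorem id_T (X : OCP A) : Hom.T (𝟙 X) = ContinuousLinearMap.id ℂ X.K := rfl
@[simp] theorem comp_T {X Y Z : OCP A} (f : X ⟶ Y) (g : Y ⟶ Z) : (f ≫ g).T = g.T ∘L f.T := rfl

/-- Pulling back along `f : A' → A`: `(K, φ) ↦ (K, φ ∘ f)`, `T ↦ T`. -/
noncomputable def pull (f : A' →⋆ₐ[ℂ] A) : OCP A ⥤ OCP A' where
  obj X := ⟨X.K, compCP X.φ f⟩
  map t := ⟨t.T, fun a => t.comm (f a)⟩

end OCP

/-- The functor `OCP : C*-Alg^op → CAT`. -/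
noncomputable def functorOCP : CStarAlgCat.{u}ᵒᵖ ⥤ Cat.{u, u + 1} where
  obj A := Cat.of (OCP A.unop)
  map f := (OCP.pull f.unop).toCatHom
  map_id _ := rfl
  map_comp _ _ := rfl

/-- An anchored representation `(K, H, π, V)` of `A`: Hilbert spaces `K` and `H`, a unital
*-homomorphism `π : A → B(H)` and a bounded operator `V : K → H`. -/
structure AnRep (A : CStarAlgCat.{u}) : Type (u + 1) where
  K : Type u
  H : Type u
  [groupK : NormedAddCommGroup K]
  [innerK : InnerProductSpace ℂ K]
  [completeK : CompleteSpace K]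
  [groupH : NormedAddCommGroup H]
  [innerH : InnerProductSpace ℂ H]
  [completeH : CompleteSpace H]
  π : A →⋆ₐ[ℂ] (H →L[ℂ] H)
  V : K →L[ℂ] H

attribute [instance] AnRep.groupK AnRep.innerK AnRep.completeK AnRep.groupH AnRep.innerH
  AnRep.completeH

namespace AnRep

variable {A A' : CStarAlgCat.{u}}

/-- A morphism `(K, H, π, V) → (L, I, ρ, W)`: bounded operators `T : K → L` and `L : H → I` with
`L π(a) = ρ(a) L`, `L V = W T` and `T V* = W* L`. -/
@[ext]
structure Hom (X Y : AnRep A) : Type u where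
  T : X.K →L[ℂ] Y.K
  L : X.H →L[ℂ] Y.H
  comm : ∀ a, L ∘L X.π a = Y.π a ∘L L
  anchor : L ∘L X.V = Y.V ∘L T
  anchor_adjoint : T ∘L X.V.adjoint = Y.V.adjoint ∘L L

instance : Category (AnRep A) where
  Hom := Hom
  id X := ⟨ContinuousLinearMap.id ℂ X.K, ContinuousLinearMap.id ℂ X.H, fun _ => rfl, rfl, rfl⟩
  comp f g := ⟨g.T ∘L f.T, g.L ∘L f.L,
    fun a => by
      rw [ContinuousLinearMap.comp_assoc, f.comm, ← ContinuousLinearMap.comp_assoc, g.comm,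
        ContinuousLinearMap.comp_assoc],
    by rw [ContinuousLinearMap.comp_assoc, f.anchor, ← ContinuousLinearMap.comp_assoc, g.anchor,
        ContinuousLinearMap.comp_assoc],
    by rw [ContinuousLinearMap.comp_assoc, f.anchor_adjoint, ← ContinuousLinearMap.comp_assoc,
        g.anchor_adjoint, ContinuousLinearMap.comp_assoc]⟩

@[ext]
theorem hom_ext {X Y : AnRep A} {f g : X ⟶ Y} (h : f.T = g.T) (h' : f.L = g.L) : f = g :=
  Hom.ext h h'

@[simp] theorem id_T (X : AnRep A) : Hom.T (𝟙 X) = ContinuousLinearMap.id ℂ X.K := rfl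
@[simp] theorem id_L (X : AnRep A) : Hom.L (𝟙 X) = ContinuousLinearMap.id ℂ X.H := rfl
@[simp] theorem comp_T {X Y Z : AnRep A} (f : X ⟶ Y) (g : Y ⟶ Z) : (f ≫ g).T = g.T ∘L f.T := rfl
@[simp] theorem comp_L {X Y Z : AnRep A} (f : X ⟶ Y) (g : Y ⟶ Z) : (f ≫ g).L = g.L ∘L f.L := rfl

/-- Pulling back along `f : A' → A`: `(K, H, π, V) ↦ (K, H, π ∘ f, V)`, `(T, L) ↦ (T, L)`. -/
noncomputable def pull (f : A' →⋆ₐ[ℂ] A) : AnRep A ⥤ AnRep A' where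
  obj X := ⟨X.K, X.H, X.π.comp f, X.V⟩
  map t := ⟨t.T, t.L, fun a => t.comm (f a), t.anchor, t.anchor_adjoint⟩

end AnRep

/-- The functor `AnRep : C*-Alg^op → CAT`. -/
noncomputable def functorAnRep : CStarAlgCat.{u}ᵒᵖ ⥤ Cat.{u, u + 1} where
  obj A := Cat.of (AnRep A.unop)
  map f := (AnRep.pull f.unop).toCatHom
  map_id _ := rfl
  map_comp _ _ := rfl

/-- An operator state: a unital completely positive map `φ : A → B(K)`. -/
structure OpSt (A : CStarAlgCat.{u}) : Type (u + 1) extends OCP A where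
  unital : φ 1 = 1

namespace OpSt

variable {A A' : CStarAlgCat.{u}}

/-- A morphism of operator states: a morphism of the underlying operator-valued completely
positive maps that is an isometry. -/
@[ext]
structure Hom (X Y : OpSt A) : Type u where
  hom : X.toOCP ⟶ Y.toOCP
  isometry : Isometry hom.T

instance : Category (OpSt A) where
  Hom := Hom
  id X := ⟨𝟙 X.toOCP, isometry_id⟩
  comp f g := ⟨f.hom ≫ g.hom, g.isometry.comp f.isometry⟩

@[ext]
theorem hom_ext {X Y : OpSt A} {f g : X ⟶ Y} (h : f.hom = g.hom) : f = g := Hom.ext h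

/-- The inclusion `OpSt(A) → OCP(A)`. -/
def incl (A : CStarAlgCat.{u}) : OpSt A ⥤ OCP A where
  obj X := X.toOCP
  map f := f.hom

/-- Pulling back along `f : A' → A`: `(K, φ) ↦ (K, φ ∘ f)`, `T ↦ T`. -/
noncomputable def pull (f : A' →⋆ₐ[ℂ] A) : OpSt A ⥤ OpSt A' where
  obj X := ⟨(OCP.pull f).obj X.toOCP, (congrArg X.φ (map_one f)).trans X.unital⟩
  map t := ⟨(OCP.pull f).map t.hom, t.isometry⟩

end OpSt

/-- The functor `OpSt : C*-Alg^op → CAT`. -/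
noncomputable def functorOpSt : CStarAlgCat.{u}ᵒᵖ ⥤ Cat.{u, u + 1} where
  obj A := Cat.of (OpSt A.unop)
  map f := (OpSt.pull f.unop).toCatHom
  map_id _ := rfl
  map_comp _ _ := rfl

/-- A preserving anchored representation: one whose anchor `V` is an isometry. -/
structure PAnRep (A : CStarAlgCat.{u}) : Type (u + 1) extends AnRep A where
  isometry : Isometry V

namespace PAnRep

variable {A A' : CStarAlgCat.{u}}

/-- A morphism of preserving anchored representations: a morphism `(T, L)` of anchored
representations in which `T` and `L` are isometries. -/
@[ext]
structure Hom (X Y : PAnRep A) : Type u where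
  hom : X.toAnRep ⟶ Y.toAnRep
  isometry_T : Isometry hom.T
  isometry_L : Isometry hom.L

instance : Category (PAnRep A) where
  Hom := Hom
  id X := ⟨𝟙 X.toAnRep, isometry_id, isometry_id⟩
  comp f g := ⟨f.hom ≫ g.hom, g.isometry_T.comp f.isometry_T, g.isometry_L.comp f.isometry_L⟩

@[ext]
theorem hom_ext {X Y : PAnRep A} {f g : X ⟶ Y} (h : f.hom = g.hom) : f = g := Hom.ext h

/-- The inclusion `PAnRep(A) → AnRep(A)`. -/
def incl (A : CStarAlgCat.{u}) : PAnRep A ⥤ AnRep A where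
  obj X := X.toAnRep
  map f := f.hom

/-- Pulling back along `f : A' → A`: `(K, H, π, V) ↦ (K, H, π ∘ f, V)`, `(T, L) ↦ (T, L)`. -/
noncomputable def pull (f : A' →⋆ₐ[ℂ] A) : PAnRep A ⥤ PAnRep A' where
  obj X := ⟨(AnRep.pull f).obj X.toAnRep, X.isometry⟩
  map t := ⟨(AnRep.pull f).map t.hom, t.isometry_T, t.isometry_L⟩

end PAnRep

/-- The functor `PAnRep : C*-Alg^op → CAT`. -/
noncomputable def functorPAnRep : CStarAlgCat.{u}ᵒᵖ ⥤ Cat.{u, u + 1} where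
  obj A := Cat.of (PAnRep A.unop)
  map f := (PAnRep.pull f.unop).toCatHom
  map_id _ := rfl
  map_comp _ _ := rfl

section Construct

universe v₁ u₁ v₂ u₂

variable {C : Type u₁} [Category.{v₁} C] {F G : C ⥤ Cat.{v₂, u₂}}

/-- An oplax-natural transformation between strict functors `F, G : C → CAT`: functors
`app c : F c → G c`, and natural transformations `nat f : app b ∘ F f ⇒ G f ∘ app a` for
`f : a → b`, with the two coherence conditions written out on objects. -/
@[simps]
def mkOplax (app : ∀ c, F.obj c ⟶ G.obj c)
    (nat : ∀ {a b : C} (f : a ⟶ b), F.map f ≫ app b ⟶ app a ≫ G.map f)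
    (nat_id : ∀ (a : C) (X : F.obj a), (nat (𝟙 a)).toNatTrans.app X = eqToHom (by simp))
    (nat_comp : ∀ {a b c : C} (f : a ⟶ b) (g : b ⟶ c) (X : F.obj a),
      (nat (f ≫ g)).toNatTrans.app X =
        eqToHom (by simp) ≫ (nat g).toNatTrans.app ((F.map f).toFunctor.obj X) ≫
          (G.map g).toFunctor.map ((nat f).toNatTrans.app X) ≫ eqToHom (by simp)) :
    F.toOplaxFunctor' ⟶ G.toOplaxFunctor' where
  app c := app c.as
  naturality f := nat f.as
  naturality_naturality {a b f g} η := by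
    obtain rfl := LocallyDiscrete.eq_of_hom η
    obtain rfl : η = 𝟙 _ := Subsingleton.elim _ _
    rw [PrelaxFunctor.map₂_id, PrelaxFunctor.map₂_id]
    exact ((congrArg (· ≫ nat f.as) (Bicategory.id_whiskerRight (F.map f.as) (app b.as))).trans
      (Category.id_comp _)).trans ((congrArg (nat f.as ≫ ·)
        (Bicategory.whiskerLeft_id (app a.as) (G.map f.as))).trans (Category.comp_id _)).symm
  naturality_id a := by
    obtain ⟨a⟩ := a
    have key : ∀ X : F.obj a, (nat (𝟙 a)).toNatTrans.app X ≫
        (eqToHom (G.map_id a)).toNatTrans.app ((app a).toFunctor.obj X) =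
        (app a).toFunctor.map ((eqToHom (F.map_id a)).toNatTrans.app X) := fun X => by
      rw [nat_id, Cat.eqToHom_app, Cat.eqToHom_app, eqToHom_map, eqToHom_trans]
    refine Cat.Hom₂.ext (NatTrans.ext (funext fun X => (key X).trans ?_))
    exact ((congrArg _ (Category.comp_id _)).trans (Category.comp_id _)).symm
  naturality_comp {a b c} f g := by
    have key : ∀ {a b c : C} (f : a ⟶ b) (g : b ⟶ c) (X : F.obj a),
        (nat (f ≫ g)).toNatTrans.app X ≫
        (eqToHom (G.map_comp f g)).toNatTrans.app ((app a).toFunctor.obj X) =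
        (app c).toFunctor.map ((eqToHom (F.map_comp f g)).toNatTrans.app X) ≫
        (nat g).toNatTrans.app ((F.map f).toFunctor.obj X) ≫
          (G.map g).toFunctor.map ((nat f).toNatTrans.app X) := fun {a b c} f g X => by
      rw [nat_comp, Cat.eqToHom_app, Cat.eqToHom_app, eqToHom_map]
      simp only [Category.assoc, eqToHom_trans, eqToHom_refl]
      exact congrArg _ (congrArg _ (Category.comp_id _))
    refine Cat.Hom₂.ext (NatTrans.ext (funext fun X => (key f.as g.as X).trans ?_))
    refine congrArg _ ?_
    refine (Category.id_comp _).symm.trans (congrArg _ (congrArg _ ?_))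
    exact (Category.id_comp _).symm.trans (congrArg _ (Category.comp_id _).symm)

end Construct

variable {A A' : CStarAlgCat.{u}}

/-- The 2-category in which the adjunction lives: functors `C*-Alg^op → CAT`, oplax-natural
transformations and modifications. (Mathlib's bicategory has all oplax functors as objects; all
those used here are strict functors, and the strict functors form a full sub-2-category, with the
same 1-morphisms, 2-morphisms and adjunctions between strict functors.) -/
abbrev FunCat : Type (u + 2) := LocallyDiscrete CStarAlgCat.{u}ᵒᵖ ⥤ᵒᵖᴸ Cat.{u, u + 1}

/-- `OCP` as an object of the 2-category of functors `C*-Alg^op → CAT`. -/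
noncomputable abbrev OCPFun : FunCat.{u} := functorOCP.toOplaxFunctor'

/-- `AnRep` as an object of the 2-category of functors `C*-Alg^op → CAT`. -/
noncomputable abbrev AnRepFun : FunCat.{u} := functorAnRep.toOplaxFunctor'

/-- `OpSt` as an object of the 2-category of functors `C*-Alg^op → CAT`. -/
noncomputable abbrev OpStFun : FunCat.{u} := functorOpSt.toOplaxFunctor'

/-- `PAnRep` as an object of the 2-category of functors `C*-Alg^op → CAT`. -/
noncomputable abbrev PAnRepFun : FunCat.{u} := functorPAnRep.toOplaxFunctor'

/-! Restriction -/

/-- `rest_A : AnRep(A) → OCP(A)`, `(K, H, π, V) ↦ (K, V* π(·) V)`, `(T, L) ↦ T`. -/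
noncomputable def restFunctor (A : CStarAlgCat.{u}) : AnRep A ⥤ OCP A where
  obj X := ⟨X.K, compress X.π X.V⟩
  map {X Y} t := ⟨t.T, fun a => by
    change t.T ∘L (X.V.adjoint ∘L (X.π a ∘L X.V)) = (Y.V.adjoint ∘L (Y.π a ∘L Y.V)) ∘L t.T
    rw [← ContinuousLinearMap.comp_assoc, t.anchor_adjoint, ContinuousLinearMap.comp_assoc,
      ← ContinuousLinearMap.comp_assoc t.L, t.comm, ContinuousLinearMap.comp_assoc, t.anchor]
    rfl⟩

/-- Restriction commutes strictly with pulling back. -/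
noncomputable def restNat (f : A' →⋆ₐ[ℂ] A) :
    AnRep.pull f ⋙ restFunctor A' ⟶ restFunctor A ⋙ OCP.pull f where
  app X := ⟨ContinuousLinearMap.id ℂ X.K, fun _ => rfl⟩

/-- The natural transformation `rest : AnRep ⇒ OCP`. -/
noncomputable def rest : AnRepFun.{u} ⟶ OCPFun.{u} :=
  mkOplax (fun A => (restFunctor A.unop).toCatHom) (fun f => (restNat f.unop).toCatHom₂)
    (fun _ _ => rfl) (fun _ _ _ => rfl)

/-! Stinespring's construction -/

/-- `Stine_A : OCP(A) → AnRep(A)`, `(K, φ) ↦ (K, H_φ, π_φ, V_φ)`, `T ↦ (T, L_T)`. -/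
noncomputable def stineFunctor (A : CStarAlgCat.{u}) : OCP A ⥤ AnRep A where
  obj X := ⟨X.K, StineSpace X.φ, stineRep X.φ, stineV X.φ⟩
  map {X Y} t :=
    { T := t.T
      L := stineMap X.φ Y.φ t.T t.comm
      comm := stineMap_comm X.φ Y.φ t.T t.comm
      anchor := stineMap_anchor X.φ Y.φ t.T t.comm
      anchor_adjoint := stineMap_anchor_adjoint X.φ Y.φ t.T t.comm }
  map_id X := AnRep.hom_ext rfl (clm_ext fun b v => by simp)
  map_comp f g := AnRep.hom_ext rfl (clm_ext fun b v => by simp)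

/-- The morphism `(id_K, L_f)` from the Stinespring representation of `φ ∘ f` to the pullback
along `f` of that of `φ`. -/
noncomputable def stineNat (f : A' →⋆ₐ[ℂ] A) :
    OCP.pull f ⋙ stineFunctor A' ⟶ stineFunctor A ⋙ AnRep.pull f where
  app X :=
    { T := ContinuousLinearMap.id ℂ X.K
      L := stineComp X.φ f
      comm := stineComp_comm X.φ f
      anchor := stineComp_anchor X.φ f
      anchor_adjoint := stineComp_anchor_adjoint X.φ f }
  naturality X Y t := AnRep.hom_ext rfl
    (stineComp_natural X.φ Y.φ f t.T t.comm (fun a => t.comm (f a)))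

theorem stineNat_id (X : OCP A) :
    (stineNat (StarAlgHom.id ℂ A)).app X = 𝟙 ((stineFunctor A).obj X) :=
  AnRep.hom_ext rfl (clm_ext (φ := X.φ) fun b v => stineComp_cls X.φ (StarAlgHom.id ℂ A) b v)

theorem stineNat_comp {A'' : CStarAlgCat.{u}} (f : A' →⋆ₐ[ℂ] A) (g : A'' →⋆ₐ[ℂ] A') (X : OCP A) :
    (stineNat (f.comp g)).app X =
      (stineNat g).app ((OCP.pull f).obj X) ≫ (AnRep.pull g).map ((stineNat f).app X) :=
  AnRep.hom_ext rfl (clm_ext (φ := compCP X.φ (f.comp g)) fun b v => by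
    exact (stineComp_cls X.φ (f.comp g) b v).trans ((congrArg (stineComp X.φ f)
      (stineComp_cls (compCP X.φ f) g b v)).trans (stineComp_cls X.φ f (g b) v)).symm)

/-- Stinespring's oplax-natural transformation `Stine : OCP ⇒ AnRep`. -/
noncomputable def Stine : OCPFun.{u} ⟶ AnRepFun.{u} :=
  mkOplax (fun A => (stineFunctor A.unop).toCatHom) (fun f => (stineNat f.unop).toCatHom₂)
    (fun _ X => stineNat_id X)
    (fun f g X => (stineNat_comp f.unop g.unop X).trans
      ((Category.id_comp _).trans (congrArg _ (Category.comp_id _))).symm)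

/-! The counit -/

/-- `m_A : Stine_A ∘ rest_A ⇒ id`, with component `(id_K, m_{π,V})` at `(K, H, π, V)`. -/
noncomputable def counitNat (A : CStarAlgCat.{u}) :
    restFunctor A ⋙ stineFunctor A ⟶ 𝟭 (AnRep A) where
  app X :=
    { T := ContinuousLinearMap.id ℂ X.K
      L := counitMap X.π X.V
      comm := counitMap_comm X.π X.V
      anchor := counitMap_anchor X.π X.V
      anchor_adjoint := counitMap_anchor_adjoint X.π X.V }
  naturality X Y t := AnRep.hom_ext rfl
    (counitMap_natural X.π X.V Y.π Y.V t.comm t.anchor ((restFunctor A).map t).comm)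

theorem counitNat_modification (f : A' →⋆ₐ[ℂ] A) (X : AnRep A) :
    (stineFunctor A').map ((restNat f).app X) ≫ (stineNat f).app ((restFunctor A).obj X) ≫
      (AnRep.pull f).map ((counitNat A).app X) = (counitNat A').app ((AnRep.pull f).obj X) :=
  AnRep.hom_ext rfl (counitMap_comp f X.π X.V ((restNat f).app X).comm)

/-- The modification `m : Stine ∘ rest ⇛ id`. -/
noncomputable def stineCounit : rest.{u} ≫ Stine.{u} ⟶ 𝟙 AnRepFun.{u} where
  as :=
    { app := fun A => (counitNat A.as.unop).toCatHom₂
      naturality := fun f => Cat.Hom₂.ext (NatTrans.ext (funext fun X => by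
        exact (counitNat_modification f.as.unop X).symm)) }

/-! Operator states and preserving anchored representations -/

/-- The restriction functor `PAnRep(A) → OpSt(A)`. -/
noncomputable def restPFunctor (A : CStarAlgCat.{u}) : PAnRep A ⥤ OpSt A where
  obj X := ⟨(restFunctor A).obj X.toAnRep, compress_one X.π X.V X.isometry⟩
  map t := ⟨(restFunctor A).map t.hom, t.isometry_T⟩

/-- Restriction commutes strictly with pulling back. -/
noncomputable def restPNat (f : A' →⋆ₐ[ℂ] A) :
    PAnRep.pull f ⋙ restPFunctor A' ⟶ restPFunctor A ⋙ OpSt.pull f where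
  app X := ⟨(restNat f).app X.toAnRep, isometry_id⟩

/-- The natural transformation `rest : PAnRep ⇒ OpSt`. -/
noncomputable def restP : PAnRepFun.{u} ⟶ OpStFun.{u} :=
  mkOplax (fun A => (restPFunctor A.unop).toCatHom) (fun f => (restPNat f.unop).toCatHom₂)
    (fun _ _ => rfl) (fun _ _ _ => rfl)

/-- Stinespring's construction as a functor `OpSt(A) → PAnRep(A)`. -/
noncomputable def stinePFunctor (A : CStarAlgCat.{u}) : OpSt A ⥤ PAnRep A where
  obj X := ⟨(stineFunctor A).obj X.toOCP, stineV_isometry X.φ X.unital⟩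
  map {X Y} t := ⟨(stineFunctor A).map t.hom, t.isometry,
    stineMap_isometry X.φ Y.φ t.hom.T t.hom.comm t.isometry⟩
  map_id X := PAnRep.hom_ext ((stineFunctor A).map_id X.toOCP)
  map_comp f g := PAnRep.hom_ext ((stineFunctor A).map_comp f.hom g.hom)

/-- The morphism `(id_K, L_f)` in the category of preserving anchored representations. -/
noncomputable def stinePNat (f : A' →⋆ₐ[ℂ] A) :
    OpSt.pull f ⋙ stinePFunctor A' ⟶ stinePFunctor A ⋙ PAnRep.pull f where
  app X := ⟨(stineNat f).app X.toOCP, isometry_id, stineComp_isometry X.φ f⟩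
  naturality _ _ t := PAnRep.hom_ext ((stineNat f).naturality t.hom)

/-- Stinespring's oplax-natural transformation `Stine : OpSt ⇒ PAnRep`. -/
noncomputable def StineP : OpStFun.{u} ⟶ PAnRepFun.{u} :=
  mkOplax (fun A => (stinePFunctor A.unop).toCatHom) (fun f => (stinePNat f.unop).toCatHom₂)
    (fun _ X => PAnRep.hom_ext (stineNat_id X.toOCP))
    (fun f g X => PAnRep.hom_ext ((stineNat_comp f.unop g.unop X.toOCP).trans
      ((Category.id_comp _).trans (congrArg _ (Category.comp_id _))).symm))

/-- The natural transformation `m_A` on preserving anchored representations. -/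
noncomputable def counitPNat (A : CStarAlgCat.{u}) :
    restPFunctor A ⋙ stinePFunctor A ⟶ 𝟭 (PAnRep A) where
  app X := ⟨(counitNat A).app X.toAnRep, isometry_id, counitMap_isometry X.π X.V⟩
  naturality _ _ t := PAnRep.hom_ext ((counitNat A).naturality t.hom)

/-- The modification `m` on preserving anchored representations. -/
noncomputable def stinePCounit : restP.{u} ≫ StineP.{u} ⟶ 𝟙 PAnRepFun.{u} where
  as :=
    { app := fun A => (counitPNat A.as.unop).toCatHom₂
      naturality := fun f => Cat.Hom₂.ext (NatTrans.ext (funext fun X =>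
        PAnRep.hom_ext (counitNat_modification f.as.unop X.toAnRep).symm)) }

/-- The inclusion `OpSt ⇒ OCP`. -/
noncomputable def inclOpSt : OpStFun.{u} ⟶ OCPFun.{u} :=
  mkOplax (fun A => (OpSt.incl A.unop).toCatHom)
    (fun f => (show OpSt.pull f.unop ⋙ OpSt.incl _ ⟶ OpSt.incl _ ⋙ OCP.pull f.unop from
      { app := fun X => 𝟙 _ }).toCatHom₂)
    (fun _ _ => rfl) (fun _ _ _ => rfl)

/-- The inclusion `PAnRep ⇒ AnRep`. -/
noncomputable def inclPAnRep :
    PAnRepFun.{u} ⟶ AnRepFun.{u} :=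
  mkOplax (fun A => (PAnRep.incl A.unop).toCatHom)
    (fun f => (show PAnRep.pull f.unop ⋙ PAnRep.incl _ ⟶ PAnRep.incl _ ⋙ AnRep.pull f.unop from
      { app := fun X => 𝟙 _ }).toCatHom₂)
    (fun _ _ => rfl) (fun _ _ _ => rfl)

end Stinespring

open Stinespring

/-!
Both adjunctions are checked one C*-algebra and one object at a time.

On objects, `V_φ* π_φ(a) V_φ v = V_φ* [a ⊗ v] = φ(a) v`, so compressing the Stinespring
representation of `φ` gives back `φ` (`compress_stine`). Hence `rest ∘ Stine` fixes every object
`(K, φ)`. This equality of objects is not definitional, but the Hilbert space `K` is the same on both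
sides, and the transport morphisms `eqToHom` along it have the identity of `K` as underlying operator
(`eqToHom_eq_stineUnit`, `eqToHom_eq_stineUnitInv`). Together with `T ↦ (T, L_T) ↦ T` and
`(id_K, L_f) ↦ id_K`, this yields `rest ∘ Stine = id` as oplax-natural transformations (`Stine_rest`),
by the extensionality criterion `oplaxTrans_ext`.

The 2-morphism `eqToHom` of this equality therefore has component `id_K` at `(K, φ)`, and by
`exists_adjunction_of_comp_eq_id` the triangle identities reduce to two computations. After applying
`rest`, the component `(id_K, m_{π,V})` of the counit is `id_K` (`stineUnit_comp_restFunctor_map`).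
At the Stinespring representation of `φ`, the composite of `L_{id_K}` with the counit sends
`[a ⊗ v]` to `π_φ(a) V_φ v = [a ⊗ v]` (`stineFunctor_map_stineUnit_comp`).

The inclusions of operator states and of preserving anchored representations are faithful, so there
all identities follow from those for `OCP` and `AnRep`.
-/

namespace Stinespring

/-! ### Oplax transformations and modifications with values in categories -/

section OplaxTransformations

universe v₁ u₁ v₂ u₂ w

variable {B : Type u₁} [Bicategory.{w, v₁} B] {F G : B ⥤ᵒᵖᴸ Cat.{v₂, u₂}}

/-- Oplax transformations between `Cat`-valued oplax functors are equal if their component functors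
are equal and the components of their 2-cells agree up to the induced identifications of objects. -/
theorem oplaxTrans_ext {η θ : F ⟶ G} (happ : ∀ a, η.app a = θ.app a)
    (hnat : ∀ {a b : B} (f : a ⟶ b) (X : F.obj a),
      (η.naturality f).toNatTrans.app X =
        eqToHom (by rw [happ b]) ≫ (θ.naturality f).toNatTrans.app X ≫
          eqToHom (by rw [happ a])) : η = θ := by
  obtain ⟨app, nat, _, _, _⟩ := η
  obtain ⟨app', nat', _, _, _⟩ := θ
  obtain rfl : app = app' := funext happ
  obtain rfl : @nat = @nat' := by
    funext a b f
    refine Cat.Hom₂.ext (NatTrans.ext (funext fun X => (hnat f X).trans ?_))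
    exact (Category.id_comp _).trans (Category.comp_id _)
  rfl

theorem oplaxTrans_id_naturality_app {a b : B} (f : a ⟶ b) (X : F.obj a) :
    (Oplax.OplaxTrans.naturality (𝟙 F) f).toNatTrans.app X = 𝟙 _ :=
  Category.comp_id _

theorem oplaxTrans_comp_naturality_app {H : B ⥤ᵒᵖᴸ Cat.{v₂, u₂}} (η : F ⟶ G) (θ : G ⟶ H)
    {a b : B} (f : a ⟶ b) (X : F.obj a) :
    ((η ≫ θ).naturality f).toNatTrans.app X =
      (θ.app b).toFunctor.map ((η.naturality f).toNatTrans.app X) ≫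
        (θ.naturality f).toNatTrans.app ((η.app a).toFunctor.obj X) := by
  simp
  rfl

theorem modification_eqToHom_app {η θ : F ⟶ G} (h : η = θ) (a : B) (X : F.obj a) :
    ((eqToHom h).as.app a).toNatTrans.app X = eqToHom (by rw [h]) := by
  subst h; rfl

/-- If `θ ∘ η` is the identity, then a modification `η ∘ θ ⇛ id` is the counit of an adjunction
`η ⊣ θ` with the identity as unit as soon as the triangle identities hold on objects. -/
theorem exists_adjunction_of_comp_eq_id {η : F ⟶ G} {θ : G ⟶ F} (h : η ≫ θ = 𝟙 F)
    (counit : θ ≫ η ⟶ 𝟙 G)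
    (left : ∀ (a : B) (X : F.obj a)
      (e : X = (θ.app a).toFunctor.obj ((η.app a).toFunctor.obj X)),
      (η.app a).toFunctor.map (eqToHom e) ≫
        (counit.as.app a).toNatTrans.app ((η.app a).toFunctor.obj X) = 𝟙 _)
    (right : ∀ (a : B) (Y : G.obj a)
      (e : (θ.app a).toFunctor.obj Y =
        (θ.app a).toFunctor.obj ((η.app a).toFunctor.obj ((θ.app a).toFunctor.obj Y))),
      eqToHom e ≫ (θ.app a).toFunctor.map ((counit.as.app a).toNatTrans.app Y) = 𝟙 _) :
    ∃ adj : Bicategory.Adjunction η θ, adj.unit = eqToHom h.symm ∧ adj.counit = counit := by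
  refine ⟨⟨eqToHom h.symm, counit, ?_, ?_⟩, rfl, rfl⟩
  · refine Oplax.OplaxTrans.homCategory.ext fun a =>
      Cat.Hom₂.ext (NatTrans.ext (funext fun X => ?_))
    have key : (η.app a).toFunctor.map (((eqToHom h.symm).as.app a).toNatTrans.app X) ≫
        (counit.as.app a).toNatTrans.app ((η.app a).toFunctor.obj X) = 𝟙 _ :=
      (congrArg (fun t => (η.app a).toFunctor.map t ≫ _)
        (modification_eqToHom_app h.symm a X)).trans (left a X _)
    -- The unit is made opaque so that `simp` keeps it in this form.
    generalize eqToHom h.symm = unit at key ⊢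
    simp [leftZigzag, bicategoricalComp]
    -- The associator and the unitors of `Cat` have identity components.
    exact (congrArg _ (Category.id_comp _)).trans
      (key.trans (Category.comp_id _).symm)
  · refine Oplax.OplaxTrans.homCategory.ext fun a =>
      Cat.Hom₂.ext (NatTrans.ext (funext fun Y => ?_))
    have key : ((eqToHom h.symm).as.app a).toNatTrans.app ((θ.app a).toFunctor.obj Y) ≫
        (θ.app a).toFunctor.map ((counit.as.app a).toNatTrans.app Y) = 𝟙 _ :=
      (congrArg (· ≫ (θ.app a).toFunctor.map ((counit.as.app a).toNatTrans.app Y))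
        (modification_eqToHom_app h.symm a _)).trans (right a Y _)
    generalize eqToHom h.symm = unit at key ⊢
    simp [rightZigzag, bicategoricalComp]
    exact (congrArg _ (Category.id_comp _)).trans
      (key.trans (Category.comp_id _).symm)

end OplaxTransformations

variable {A A' : CStarAlgCat.{u}}

/-! ### Restricting the Stinespring representation -/

/-- The dilation property `V_φ* π_φ(a) V_φ = φ(a)`. -/
theorem compress_stine {A : Type*} [CStarAlgebra A] [PartialOrder A] [StarOrderedRing A]
    {K : Type*} [NormedAddCommGroup K] [InnerProductSpace ℂ K] [CompleteSpace K]
    (φ : A →CP (K →L[ℂ] K)) : compress (stineRep φ) (stineV φ) = φ := by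
  refine DFunLike.ext _ _ fun a => ?_
  ext v
  simp

/-- Transport along an equality of completely positive maps on the same Hilbert space `K` is
`id_K`. -/
theorem OCP.eqToHom_mk {K : Type u} [NormedAddCommGroup K] [InnerProductSpace ℂ K]
    [CompleteSpace K] {φ ψ : A →CP (K →L[ℂ] K)} (h : φ = ψ) (h' : OCP.mk K φ = OCP.mk K ψ) :
    eqToHom h' = OCP.Hom.mk (X := OCP.mk K φ) (Y := OCP.mk K ψ) (ContinuousLinearMap.id ℂ K)
      fun a => by rw [h]; rfl := by
  subst h; rfl

theorem restFunctor_stineFunctor_obj (X : OCP A) :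
    (restFunctor A).obj ((stineFunctor A).obj X) = X :=
  congrArg (OCP.mk X.K) (compress_stine X.φ)

/-- The morphism `id_K : (K, φ) → (K, V_φ* π_φ(·) V_φ)`. -/
def stineUnit (X : OCP A) : X ⟶ (restFunctor A).obj ((stineFunctor A).obj X) :=
  OCP.Hom.mk (ContinuousLinearMap.id ℂ X.K) fun a => by
    change _ = compress (stineRep X.φ) (stineV X.φ) a ∘L _
    rw [compress_stine]; rfl

/-- The morphism `id_K : (K, V_φ* π_φ(·) V_φ) → (K, φ)`. -/
def stineUnitInv (X : OCP A) : (restFunctor A).obj ((stineFunctor A).obj X) ⟶ X :=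
  OCP.Hom.mk (ContinuousLinearMap.id ℂ X.K) fun a => by
    change _ ∘L compress (stineRep X.φ) (stineV X.φ) a = _
    rw [compress_stine]; rfl

theorem eqToHom_eq_stineUnit (X : OCP A) (h : X = (restFunctor A).obj ((stineFunctor A).obj X)) :
    eqToHom h = stineUnit X :=
  OCP.eqToHom_mk (compress_stine X.φ).symm h

theorem eqToHom_eq_stineUnitInv (X : OCP A)
    (h : (restFunctor A).obj ((stineFunctor A).obj X) = X) : eqToHom h = stineUnitInv X :=
  OCP.eqToHom_mk (compress_stine X.φ) h

theorem stineFunctor_comp_restFunctor (A : CStarAlgCat.{u}) :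
    stineFunctor A ⋙ restFunctor A = 𝟭 (OCP A) :=
  CategoryTheory.Functor.ext restFunctor_stineFunctor_obj fun X Y t => by
    refine Eq.trans ?_ (congrArg₂ (· ≫ t ≫ ·) (eqToHom_eq_stineUnitInv X _)
      (eqToHom_eq_stineUnit Y _)).symm
    rfl

theorem eqToHom_pull_obj (f : A' →⋆ₐ[ℂ] A) (X : OCP A)
    (h : (OCP.pull f).obj X = (OCP.pull f).obj ((restFunctor A).obj ((stineFunctor A).obj X))) :
    eqToHom h = (OCP.pull f).map (stineUnit X) := by
  rw [← eqToHom_eq_stineUnit X (restFunctor_stineFunctor_obj X).symm, eqToHom_map]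

/-- The 2-cells of `rest ∘ Stine` are identities: restriction sends `(id_K, L_f)` to `id_K`. -/
theorem restFunctor_map_stineNat (f : A' →⋆ₐ[ℂ] A) (X : OCP A) :
    (restFunctor A').map ((stineNat f).app X) ≫ (restNat f).app ((stineFunctor A).obj X) =
      stineUnitInv ((OCP.pull f).obj X) ≫ 𝟙 _ ≫ (OCP.pull f).map (stineUnit X) :=
  OCP.hom_ext rfl

theorem Stine_rest : Stine.{u} ≫ rest.{u} = 𝟙 OCPFun.{u} := by
  refine oplaxTrans_ext
    (fun A => congrArg Functor.toCatHom (stineFunctor_comp_restFunctor A.as.unop))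
    fun {A B} f X => ?_
  refine (oplaxTrans_comp_naturality_app _ _ f X).trans ?_
  rw [oplaxTrans_id_naturality_app f X]
  exact (restFunctor_map_stineNat f.as.unop X).trans
    (congrArg₂ (· ≫ ·) (eqToHom_eq_stineUnitInv ((OCP.pull f.as.unop).obj X) _)
      (congrArg (𝟙 ((OCP.pull f.as.unop).obj X) ≫ ·) (eqToHom_pull_obj f.as.unop X _))).symm

/-! ### The triangle identities -/

/-- The first triangle identity: on `H_φ`, the composite of the counit with `L_{id_K}` sends
`[a ⊗ v]` to `π_φ(a) V_φ v = [a ⊗ v]`. -/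
theorem stineFunctor_map_stineUnit_comp (X : OCP A) :
    (stineFunctor A).map (stineUnit X) ≫ (counitNat A).app ((stineFunctor A).obj X) =
      𝟙 ((stineFunctor A).obj X) :=
  AnRep.hom_ext rfl (clm_ext (φ := X.φ) fun b v =>
    (congrArg (counitMap (stineRep X.φ) (stineV X.φ)) (stineMap_cls X.φ
      (compress (stineRep X.φ) (stineV X.φ)) (ContinuousLinearMap.id ℂ X.K)
        (stineUnit X).comm b v)).trans
      ((counitMap_cls (stineRep X.φ) (stineV X.φ) b v).trans (by simp; rfl)))

theorem stineUnit_comp_restFunctor_map (X : AnRep A) :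
    stineUnit ((restFunctor A).obj X) ≫ (restFunctor A).map ((counitNat A).app X) =
      𝟙 ((restFunctor A).obj X) :=
  OCP.hom_ext rfl

/-! ### Operator states and preserving anchored representations -/

theorem OpSt.ext_toOCP {X Y : OpSt A} (h : X.toOCP = Y.toOCP) : X = Y := by
  cases X; cases Y; cases h; rfl

theorem OpSt.hom_eqToHom {X Y : OpSt A} (h : X = Y) :
    OpSt.Hom.hom (eqToHom h) = eqToHom (congrArg OpSt.toOCP h) := by
  subst h; rfl

theorem restPFunctor_stinePFunctor_obj (X : OpSt A) :
    (restPFunctor A).obj ((stinePFunctor A).obj X) = X :=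
  OpSt.ext_toOCP (restFunctor_stineFunctor_obj X.toOCP)

/-- The morphism `id_K : (K, φ) → (K, V_φ* π_φ(·) V_φ)` of operator states. -/
def stinePUnit (X : OpSt A) : X ⟶ (restPFunctor A).obj ((stinePFunctor A).obj X) :=
  OpSt.Hom.mk (stineUnit X.toOCP) isometry_id

/-- The morphism `id_K : (K, V_φ* π_φ(·) V_φ) → (K, φ)` of operator states. -/
def stinePUnitInv (X : OpSt A) : (restPFunctor A).obj ((stinePFunctor A).obj X) ⟶ X :=
  OpSt.Hom.mk (stineUnitInv X.toOCP) isometry_id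

theorem eqToHom_eq_stinePUnit (X : OpSt A)
    (h : X = (restPFunctor A).obj ((stinePFunctor A).obj X)) : eqToHom h = stinePUnit X :=
  OpSt.hom_ext ((OpSt.hom_eqToHom h).trans (eqToHom_eq_stineUnit X.toOCP _))

theorem eqToHom_eq_stinePUnitInv (X : OpSt A)
    (h : (restPFunctor A).obj ((stinePFunctor A).obj X) = X) : eqToHom h = stinePUnitInv X :=
  OpSt.hom_ext ((OpSt.hom_eqToHom h).trans (eqToHom_eq_stineUnitInv X.toOCP _))

theorem stinePFunctor_comp_restPFunctor (A : CStarAlgCat.{u}) :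
    stinePFunctor A ⋙ restPFunctor A = 𝟭 (OpSt A) :=
  CategoryTheory.Functor.ext restPFunctor_stinePFunctor_obj fun X Y t => by
    refine Eq.trans ?_ (congrArg₂ (· ≫ t ≫ ·) (eqToHom_eq_stinePUnitInv X _)
      (eqToHom_eq_stinePUnit Y _)).symm
    rfl

theorem eqToHom_pullP_obj (f : A' →⋆ₐ[ℂ] A) (X : OpSt A)
    (h : (OpSt.pull f).obj X =
      (OpSt.pull f).obj ((restPFunctor A).obj ((stinePFunctor A).obj X))) :
    eqToHom h = (OpSt.pull f).map (stinePUnit X) := by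
  rw [← eqToHom_eq_stinePUnit X (restPFunctor_stinePFunctor_obj X).symm, eqToHom_map]

theorem StineP_restP : StineP.{u} ≫ restP.{u} = 𝟙 OpStFun.{u} := by
  refine oplaxTrans_ext
    (fun A => congrArg Functor.toCatHom (stinePFunctor_comp_restPFunctor A.as.unop))
    fun {A B} f X => ?_
  refine (oplaxTrans_comp_naturality_app _ _ f X).trans ?_
  rw [oplaxTrans_id_naturality_app f X]
  exact (OpSt.hom_ext (restFunctor_map_stineNat f.as.unop X.toOCP)).trans
    (congrArg₂ (· ≫ ·) (eqToHom_eq_stinePUnitInv ((OpSt.pull f.as.unop).obj X) _)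
      (congrArg (𝟙 ((OpSt.pull f.as.unop).obj X) ≫ ·) (eqToHom_pullP_obj f.as.unop X _))).symm

theorem StineP_inclPAnRep : StineP.{u} ≫ inclPAnRep.{u} = inclOpSt.{u} ≫ Stine.{u} := by
  refine oplaxTrans_ext (fun A => rfl) fun {A B} f X => ?_
  refine (oplaxTrans_comp_naturality_app _ _ f X).trans ?_
  refine (Category.comp_id _).trans ?_
  symm
  refine (Category.id_comp _).trans ((Category.comp_id _).trans ?_)
  refine (oplaxTrans_comp_naturality_app _ _ f X).trans ?_
  -- The 2-cells of the inclusions are identities, so what remains is that `Stine` preserves them.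
  exact (congrArg (· ≫ (stineNat f.as.unop).app X.toOCP) ((stineFunctor _).map_id _)).trans
    (Category.id_comp _)

end Stinespring


theorem theorem5p4 :
    -- restriction is strictly natural
    (∀ {A B : LocallyDiscrete CStarAlgCat.{u}ᵒᵖ} (f : A ⟶ B),
      ∃ h : AnRepFun.{u}.map f ≫ rest.{u}.app B = rest.{u}.app A ≫ OCPFun.{u}.map f,
        rest.{u}.naturality f = eqToHom h) ∧
    -- `Stine ⊣ rest`, with the identity as unit and the modification `m` as counit
    (∃ (h : Stine.{u} ≫ rest.{u} = 𝟙 OCPFun.{u})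
      (adj : Bicategory.Adjunction Stine.{u} rest.{u}),
        adj.unit = eqToHom h.symm ∧ adj.counit = stineCounit.{u}) ∧
    -- `rest`, `Stine` and `m` restrict along the inclusions of `PAnRep` and `OpSt`
    restP.{u} ≫ inclOpSt.{u} = inclPAnRep.{u} ≫ rest.{u} ∧
    StineP.{u} ≫ inclPAnRep.{u} = inclOpSt.{u} ≫ Stine.{u} ∧
    (∀ (A : LocallyDiscrete CStarAlgCat.{u}ᵒᵖ) (X : PAnRep A.as.unop),
      (PAnRep.incl A.as.unop).map ((stinePCounit.{u}.as.app A).toNatTrans.app X) =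
        (stineCounit.{u}.as.app A).toNatTrans.app ((PAnRep.incl A.as.unop).obj X)) ∧
    -- and the restrictions form an adjunction, again with the identity as unit
    (∃ (h : StineP.{u} ≫ restP.{u} = 𝟙 OpStFun.{u})
      (adj : Bicategory.Adjunction StineP.{u} restP.{u}),
        adj.unit = eqToHom h.symm ∧ adj.counit = stinePCounit.{u}) := by
  refine ⟨fun _ => ⟨rfl, rfl⟩,
    ⟨Stine_rest, exists_adjunction_of_comp_eq_id Stine_rest _ (fun A X e => ?_) (fun A X e => ?_)⟩,
    rfl, StineP_inclPAnRep, fun _ _ => rfl,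
    ⟨StineP_restP, exists_adjunction_of_comp_eq_id StineP_restP _ (fun A X e => ?_) (fun A X e => ?_)⟩⟩
  · exact (congrArg (fun t => (stineFunctor A.as.unop).map t ≫ (counitNat A.as.unop).app _)
      (eqToHom_eq_stineUnit X e)).trans (stineFunctor_map_stineUnit_comp X)
  · exact (congrArg (· ≫ (restFunctor A.as.unop).map ((counitNat A.as.unop).app X))
      (eqToHom_eq_stineUnit ((restFunctor A.as.unop).obj X) e)).trans
        (stineUnit_comp_restFunctor_map X)
  · exact (congrArg (fun t => (stinePFunctor A.as.unop).map t ≫ (counitPNat A.as.unop).app _)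
      (eqToHom_eq_stinePUnit X e)).trans
        (PAnRep.hom_ext (stineFunctor_map_stineUnit_comp X.toOCP))
  · exact (congrArg (· ≫ (restPFunctor A.as.unop).map ((counitPNat A.as.unop).app X))
      (eqToHom_eq_stinePUnit ((restPFunctor A.as.unop).obj X) e)).trans
        (OpSt.hom_ext (stineUnit_comp_restFunctor_map X.toAnRep))
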